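/- A numerical semigroup is a subset $S\subseteq\mathbb N$ containing $0$, closed under addition, with finite complement $\mathbb N\setminus S$. Write $S^*=S\setminus\{0\}$, and let $m(S)=\min S^*$ be the multiplicity, $F(S)=\max(\mathbb Z\setminus S)$ the Frobenius number, $c(S)=F(S)+1$ the conductor, $L(S)=\{a\in S: a<F(S)\}$ and $R(S)=\{a\in S: a>F(S)\}$ the left and right parts, $P(S)=S^*\setminus(S^*+S^*)$ the set of primitive elements, $e(S)=|P(S)|$ the embedding dimension, and $e_l(S)=|P(S)\cap L(S)|$ the number of left primitive elements. For $m\ge 1$ let $O_m=\{0\}\cup(m+\mathbb N)$. A child of $S$ is a numerical semigroup of the form $S\setminus\{a\}$ with $a\in P(S)\cap R(S)$; the tree $\mathcal T$ has all numerical semigroups as vertices, with these parent-child relations. A descendant of $S$ is a numerical semigroup obtained from $S$ by passing to a child finitely many times (possibly zero times, so $S$ is a descendant of itself). A numerical semigroup $T$ satisfies Wilf's conjecture if $e(T)\,|L(T)|\ge c(T)$. Corollary. Let $S$ be a numerical semigroup of multiplicity $m=m(S)$ with $S\ne O_m$ and $e_l(S)\ge m/3$. Then every descendant $T$ of $S$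 in $\mathcal T$ satisfies Wilf's conjecture, i.e. $e(T)\,|L(T)|\ge c(T)$. -/

import Mathlib

/-- A numerical semigroup: a submonoid of `(ℕ, +)` with finite complement. -/
structure NumericalSemigroup extends AddSubmonoid ℕ where
  finite_compl' : {n : ℕ | n ∉ carrier}.Finite

namespace NumericalSemigroup

instance : SetLike NumericalSemigroup ℕ where
  coe S := S.carrier
  coe_injective S T h := by
    obtain ⟨⟨⟨S, _⟩, _⟩, _⟩ := S
    obtain ⟨⟨⟨T, _⟩, _⟩, _⟩ := T
    simp_all

instance : AddSubmonoidClass NumericalSemigroup ℕ where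
  zero_mem S := S.toAddSubmonoid.zero_mem
  add_mem {S} _ _ ha hb := S.toAddSubmonoid.add_mem ha hb

theorem finite_compl (S : NumericalSemigroup) : {n : ℕ | n ∉ S}.Finite :=
  S.finite_compl'

/-- The multiplicity `m(S)`: the least nonzero element of `S`. -/
noncomputable def multiplicity (S : NumericalSemigroup) : ℕ :=
  sInf {a : ℕ | a ∈ S ∧ a ≠ 0}

/-- The Frobenius number `F(S) = max (ℤ \ S)`; it is `-1` for `S = ℕ`. -/
noncomputable def frobenius (S : NumericalSemigroup) : ℤ :=
  sSup {z : ℤ | ∀ a ∈ S, (a : ℤ) ≠ z}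

/-- The conductor `c(S) = F(S) + 1`. -/
noncomputable def conductor (S : NumericalSemigroup) : ℤ :=
  S.frobenius + 1

/-- The set `P(S)` of primitive elements: nonzero elements of `S` that are not the sum of two
nonzero elements of `S`. -/
def primitives (S : NumericalSemigroup) : Set ℕ :=
  {a | a ∈ S ∧ a ≠ 0 ∧ ∀ x ∈ S, ∀ y ∈ S, x ≠ 0 → y ≠ 0 → x + y ≠ a}

/-- The left part `L(S)` of `S`. -/
def leftPart (S : NumericalSemigroup) : Set ℕ :=
  {a | a ∈ S ∧ (a : ℤ) < S.frobenius}

/-- The right part `R(S)` of `S`. -/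
def rightPart (S : NumericalSemigroup) : Set ℕ :=
  {a | a ∈ S ∧ S.frobenius < (a : ℤ)}

/-- The embedding dimension `e(S) = |P|`. -/
noncomputable def embeddingDim (S : NumericalSemigroup) : ℕ :=
  S.primitives.ncard

/-- The number `e_l(S) = |P ∩ L|` of left primitive elements. -/
noncomputable def numLeftPrimitives (S : NumericalSemigroup) : ℕ :=
  (S.primitives ∩ S.leftPart).ncard

/-- The ordinary numerical semigroup `O_m = {0} ∪ (m + ℕ)` (of interest for `m ≥ 1`). -/
def ordinary (m : ℕ) : NumericalSemigroup where
  carrier := {n | n = 0 ∨ m ≤ n}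
  zero_mem' := Or.inl rfl
  add_mem' := by
    intro a b ha hb
    simp only [Set.mem_ofPred] at *
    omega
  finite_compl' := (Set.finite_lt_nat m).subset (by
    intro n hn
    simp only [Set.mem_ofPred] at *
    omega)

/-- `S'` is a child of `S` in the tree of numerical semigroups: it is obtained from `S` by removing
one right primitive element. -/
def IsChild (S' S : NumericalSemigroup) : Prop :=
  ∃ a ∈ S.primitives ∩ S.rightPart, (S' : Set ℕ) = (S : Set ℕ) \ {a}

/-- `T` is a descendant of `S`: it is reached from `S` by finitely many (possibly zero) steps, each
from a semigroup to one of its children. -/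
def IsDescendant (T S : NumericalSemigroup) : Prop :=
  Relation.ReflTransGen (fun A B : NumericalSemigroup => B.IsChild A) S T

/-- `S` satisfies Wilf's conjecture: `e |L| ≥ c`. -/
def SatisfiesWilf (S : NumericalSemigroup) : Prop :=
  S.conductor ≤ (S.embeddingDim : ℤ) * (S.leftPart.ncard : ℤ)

/-! Well-definedness: the extremal elements above exist and the cardinalities are finite. -/

theorem exists_bound (S : NumericalSemigroup) : ∃ N : ℕ, ∀ n : ℕ, N ≤ n → n ∈ S := by
  obtain ⟨N, hN⟩ := S.finite_compl.bddAbove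
  refine ⟨N + 1, fun n hn => ?_⟩
  by_contra h
  have := hN h
  omega

theorem multiplicity_isLeast (S : NumericalSemigroup) :
    IsLeast {a : ℕ | a ∈ S ∧ a ≠ 0} S.multiplicity := by
  obtain ⟨N, hN⟩ := S.exists_bound
  have hne : {a : ℕ | a ∈ S ∧ a ≠ 0}.Nonempty := ⟨N + 1, hN _ (by omega), by omega⟩
  exact ⟨Nat.sInf_mem hne, fun a ha => Nat.sInf_le ha⟩

theorem frobenius_isGreatest (S : NumericalSemigroup) :
    IsGreatest {z : ℤ | ∀ a ∈ S, (a : ℤ) ≠ z} S.frobenius := by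
  obtain ⟨N, hN⟩ := S.exists_bound
  have hne : {z : ℤ | ∀ a ∈ S, (a : ℤ) ≠ z}.Nonempty := ⟨-1, fun a _ => by omega⟩
  have hb : BddAbove {z : ℤ | ∀ a ∈ S, (a : ℤ) ≠ z} := by
    refine ⟨N, fun z hz => ?_⟩
    by_contra h
    exact hz z.toNat (hN _ (by omega)) (by omega)
  exact ⟨Int.csSup_mem hne hb, fun z hz => le_csSup hb hz⟩

theorem leftPart_finite (S : NumericalSemigroup) : S.leftPart.Finite :=
  (Set.finite_lt_nat S.frobenius.toNat).subset (by
    intro a ha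
    have := ha.2
    simp only [Set.mem_ofPred]
    omega)

theorem primitives_finite (S : NumericalSemigroup) : S.primitives.Finite := by
  obtain ⟨N, hN⟩ := S.exists_bound
  refine (Set.finite_lt_nat (2 * N + 2)).subset fun a ha => ?_
  by_contra h
  simp only [Set.mem_ofPred, not_lt] at h
  exact ha.2.2 (N + 1) (hN _ (by omega)) (a - (N + 1)) (hN _ (by omega)) (by omega) (by omega)
    (by omega)

end NumericalSemigroup

/-!
Passing to a child removes a primitive element above the Frobenius number, so it keeps the left
primitive elements. As `S` has one, its multiplicity is a left primitive element, hence still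
belongs to `T`, and `m(T) ≤ m(S) ≤ 3 e_l(S) ≤ 3 e(T)`. This leaves Wilf's inequality for
`m ≤ 3 e`, which is due to Eliahou.

For `e ≤ 3` there are fewer than `e` pseudo-Frobenius numbers (Fröberg, Gottlieb, Häggkvist), and
every gap is a pseudo-Frobenius number minus an element of `L`, so `c - |L| ≤ (e - 1) |L|`.

For `e ≥ 4` write `c = q m - ρ` with `0 ≤ ρ < m` and let `δ(x)` count the elements below `c` in the
class mod `m` of an Apéry element `x`. With `X` the nonzero Apéry elements below `c` and `D` the
`m - e ≤ 2 e` decomposable ones, Wilf's inequality becomes `q |D| ≤ e ∑_X δ + ρ`. Every element of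
`D` is a sum `x + y` with `x, y ∈ X`, and `q + δ(x + y) ≤ δ(x) + δ(y) + ε(x + y)` with corrections
`ε ∈ {0, 1}` of total at most `ρ`. Hence `D` labels edges of a graph on `X`, and every edge has
weight `δ(x) + δ(y) ≥ q - 1`. If `X` and `D` are disjoint, there are fewer than `e` vertices and
summing the weights over all pairs suffices. If `X` meets `D`, some `b` has `δ(b) ≥ q / 2`, and
regrouping sums of three elements yields enough edges off `b` to find vertices that are disjoint
from `b` and of total weight at least `q - 1`. Thus `∑_X δ` is close to `2 q` when `|D| ≥ 7`, and
whatever is missing to `2 q` is paid for by the corrections `ε`.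
-/

section PairSums

open Finset

theorem card_le_choose_two_of_forall_exists_add {M : Type*} [AddCommMagma M] {B D : Finset M}
    (h : ∀ z ∈ D, ∃ x ∈ B, ∃ y ∈ B, x + y = z) : #D ≤ (#B + 1).choose 2 := by
  classical
  rw [← card_sym2]
  refine (card_le_card fun z hz => ?_).trans (card_image_le (f := Sym2.add))
  obtain ⟨x, hx, y, hy, rfl⟩ := h z hz
  exact mem_image.2 ⟨s(x, y), mk_mem_sym2_iff.2 ⟨hx, hy⟩, rfl⟩

theorem sum_sym2_add_map {α N : Type*} [AddCommMonoid N] (B : Finset α) (f : α → N) :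
    ∑ s ∈ B.sym2, (s.map f).add = (#B + 1) • ∑ x ∈ B, f x := by
  induction B using Finset.cons_induction with
  | empty => simp
  | cons a B ha ih =>
    rw [sym2_cons, sum_disjUnion, sum_map, ih]
    simp only [sum_cons, card_cons, Sym2.mkEmbedding_apply, Sym2.map_mk, Sym2.add_mk,
      sum_add_distrib, sum_const, add_smul, smul_add, one_smul]
    abel

end PairSums

/-- The additive relations that Eliahou's proof of Wilf's inequality extracts from the Apéry set of
a numerical semigroup. `X` is the set of nonzero Apéry elements below the conductor, `D` the set of
nonprimitive nonzero ones (so the pairs with sum in `D` are the edges of a graph on `X`), `δ x` the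
number of members of the class of `x` below the conductor, `q` the corresponding number for the
class of `0`, and `ε` a correction with values in `{0, 1}`. -/
structure SumGraph (X D : Finset ℕ) (δ ε : ℕ → ℕ) (q : ℕ) : Prop where
  pos : ∀ x ∈ X, 0 < x
  split : ∀ z ∈ D, ∃ x ∈ X, ∃ y ∈ X, x + y = z
  closed : ∀ x ∈ X, ∀ y ∈ X, ∀ w ∈ X, x + y + w ∈ D → x + y ∈ X
  weight : ∀ x ∈ X, ∀ y ∈ X, x + y ∈ D → q + δ (x + y) ≤ δ x + δ y + ε (x + y)
  one_le : ∀ x ∈ X, 1 ≤ δ x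
  correction_le_one : ∀ z, ε z ≤ 1

namespace SumGraph

open Finset

variable {X D : Finset ℕ} {δ ε : ℕ → ℕ} {q : ℕ}

theorem weight_le (h : SumGraph X D δ ε q) {x y : ℕ} (hx : x ∈ X) (hy : y ∈ X)
    (hxy : x + y ∈ D) : q ≤ δ x + δ y + 1 := by
  linarith [h.weight x hx y hy hxy, h.correction_le_one (x + y)]

theorem mul_card_le_of_split_sdiff (h : SumGraph X D δ ε q)
    (hD : ∀ z ∈ D, ∃ x ∈ X \ D, ∃ y ∈ X \ D, x + y = z) :
    q * #D ≤ (#(X \ D) + 1) * ∑ x ∈ X, δ x + ∑ z ∈ D, ε z := by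
  have hpair : ∀ z ∈ D, ∃ s ∈ (X \ D).sym2, s.add = z ∧ q ≤ (s.map δ).add + ε z := by
    intro z hz
    obtain ⟨x, hx, y, hy, rfl⟩ := hD z hz
    have := h.weight x (sdiff_subset hx) y (sdiff_subset hy) hz
    exact ⟨s(x, y), mk_mem_sym2_iff.2 ⟨hx, hy⟩, rfl,
      by rw [Sym2.map_mk, Sym2.add_mk]; omega⟩
  choose! σ hσ hadd hle using hpair
  have hinj : Set.InjOn σ D := fun z hz w hw e => by rw [← hadd z hz, e, hadd w hw]
  calc q * #D = ∑ _z ∈ D, q := by rw [sum_const, smul_eq_mul, mul_comm]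
    _ ≤ ∑ z ∈ D, ((σ z).map δ).add + ∑ z ∈ D, ε z := by
      rw [← sum_add_distrib]; exact sum_le_sum hle
    _ = ∑ s ∈ D.image σ, (s.map δ).add + ∑ z ∈ D, ε z := by rw [sum_image hinj]
    _ ≤ ∑ s ∈ (X \ D).sym2, (s.map δ).add + ∑ z ∈ D, ε z := by
      gcongr; exact image_subset_iff.2 hσ
    _ = (#(X \ D) + 1) * ∑ x ∈ X \ D, δ x + ∑ z ∈ D, ε z := by
      rw [sum_sym2_add_map, smul_eq_mul]
    _ ≤ (#(X \ D) + 1) * ∑ x ∈ X, δ x + ∑ z ∈ D, ε z := by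
      gcongr; exact sdiff_subset

theorem exists_add_eq_avoiding (h : SumGraph X D δ ε q) {x z : ℕ} (hx : x ∈ X) (hz : z ∈ D)
    (hzx : z ∉ insert (3 * x) ((X \ D).image (x + ·))) :
    ∃ u ∈ X.erase x, ∃ v ∈ X.erase x, u + v = z := by
  simp only [mem_insert, mem_image, mem_sdiff, not_or, not_exists, not_and] at hzx
  obtain ⟨hz3, hzP⟩ := hzx
  have resplit : ∀ y ∈ X, x + y = z → ∃ u ∈ X.erase x, ∃ v ∈ X.erase x, u + v = z := by
    intro y hy hxy
    have hyD : y ∈ D := by_contra fun hyD => hzP y ⟨hy, hyD⟩ hxy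
    obtain ⟨a, ha, b, hb, rfl⟩ := h.split y hyD
    have ha0 := h.pos a ha
    have hb0 := h.pos b hb
    have hxa : x + a ∈ X := h.closed x hx a ha b hb (by rwa [add_assoc, hxy])
    have hxb : x + b ∈ X := h.closed x hx b hb a ha (by rwa [add_assoc, add_comm b, hxy])
    by_cases hbx : b = x
    · exact ⟨x + b, mem_erase.2 ⟨by omega, hxb⟩, a, mem_erase.2 ⟨by omega, ha⟩, by omega⟩
    · exact ⟨x + a, mem_erase.2 ⟨by omega, hxa⟩, b, mem_erase.2 ⟨hbx, hb⟩, by omega⟩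
  obtain ⟨u, hu, v, hv, huv⟩ := h.split z hz
  by_cases hux : u = x
  · exact resplit v hv (by omega)
  by_cases hvx : v = x
  · exact resplit u hu (by omega)
  exact ⟨u, mem_erase.2 ⟨hux, hu⟩, v, mem_erase.2 ⟨hvx, hv⟩, huv⟩

theorem card_insert_image_sdiff_le (x : ℕ) :
    #(insert (3 * x) ((X \ D).image (x + ·))) ≤ #(X \ D) + 1 :=
  (card_insert_le _ _).trans (Nat.add_le_add_right card_image_le 1)

theorem exists_weight_le_avoiding (h : SumGraph X D δ ε q) {x : ℕ} (hx : x ∈ X)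
    (hd : #(X \ D) + 2 ≤ #D) :
    ∃ u ∈ X.erase x, ∃ v ∈ X.erase x, q ≤ δ u + δ v + 1 := by
  obtain ⟨z, hz, hzx⟩ := exists_mem_notMem_of_card_lt_card
    ((card_insert_image_sdiff_le (X := X) (D := D) x).trans_lt hd)
  obtain ⟨u, hu, v, hv, rfl⟩ := h.exists_add_eq_avoiding hx hz hzx
  exact ⟨u, hu, v, hv, h.weight_le (mem_of_mem_erase hu) (mem_of_mem_erase hv) hz⟩

theorem exists_ne_weight_le_avoiding (h : SumGraph X D δ ε q) {x : ℕ} (hx : x ∈ X)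
    (hd : #(X \ D) + 3 ≤ #D) :
    ∃ u ∈ X.erase x, ∃ v ∈ X.erase x, u ≠ v ∧ q ≤ δ u + δ v + 1 := by
  have hcard := le_card_sdiff (insert (3 * x) ((X \ D).image (x + ·))) D
  have hcard' := card_insert_image_sdiff_le (X := X) (D := D) x
  obtain ⟨z, hz, z', hz', hne⟩ := one_lt_card.1
    (show 1 < #(D \ insert (3 * x) ((X \ D).image (x + ·))) by omega)
  rw [mem_sdiff] at hz hz'
  obtain ⟨u, hu, v, hv, rfl⟩ := h.exists_add_eq_avoiding hx hz.1 hz.2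
  obtain ⟨u', hu', v', hv', rfl⟩ := h.exists_add_eq_avoiding hx hz'.1 hz'.2
  have hw := h.weight_le (mem_of_mem_erase hu) (mem_of_mem_erase hv) hz.1
  have hw' := h.weight_le (mem_of_mem_erase hu') (mem_of_mem_erase hv') hz'.1
  by_cases huv : u = v
  · by_cases huv' : u' = v'
    · subst huv huv'
      -- Two loops `2 u`, `2 u'` in `D` weigh together as much as two edges joining `u` to `u'`.
      exact ⟨u, hu, u', hu', by omega, by omega⟩
    · exact ⟨u', hu', v', hv', huv', hw'⟩
  · exact ⟨u, hu, v, hv, huv, hw⟩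

theorem exists_add_eq_or_eq_three_mul (h : SumGraph X D δ ε q) {s t z : ℕ} (hs : s ∈ X)
    (ht : t ∈ X) (hz : z ∈ D) :
    (∃ u ∈ X.erase (s + t), ∃ v ∈ X.erase (s + t), u + v = z) ∨ z = 3 * s := by
  have hs0 := h.pos s hs
  have ht0 := h.pos t ht
  have resplit : ∀ y ∈ X, s + t + y = z →
      (∃ u ∈ X.erase (s + t), ∃ v ∈ X.erase (s + t), u + v = z) ∨ z = 3 * s := by
    intro y hy hyz
    have hys : y + s ∈ X := h.closed y hy s hs t ht (by convert hz using 1; omega)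
    have hyt : y + t ∈ X := h.closed y hy t ht s hs (by convert hz using 1; omega)
    by_cases h1 : y = t
    · by_cases h2 : y = s
      · right; omega
      · exact Or.inl ⟨y + t, mem_erase.2 ⟨by omega, hyt⟩, s, mem_erase.2 ⟨by omega, hs⟩, by omega⟩
    · exact Or.inl ⟨y + s, mem_erase.2 ⟨by omega, hys⟩, t, mem_erase.2 ⟨by omega, ht⟩, by omega⟩
  obtain ⟨u, hu, v, hv, huv⟩ := h.split z hz
  by_cases hug : u = s + t
  · exact resplit v hv (by omega)
  by_cases hvg : v = s + t
  · exact resplit u hu (by omega)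
  exact Or.inl ⟨u, mem_erase.2 ⟨hug, hu⟩, v, mem_erase.2 ⟨hvg, hv⟩, huv⟩

theorem card_le_choose_two_add_one (h : SumGraph X D δ ε q) (hXD : (X ∩ D).Nonempty) :
    #D ≤ (#X).choose 2 + 1 := by
  obtain ⟨g, hg⟩ := hXD
  obtain ⟨hgX, hgD⟩ := mem_inter.1 hg
  obtain ⟨s, hs, t, ht, rfl⟩ := h.split g hgD
  have hcover : ∀ z ∈ D.erase (3 * s),
      ∃ u ∈ X.erase (s + t), ∃ v ∈ X.erase (s + t), u + v = z := fun z hz =>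
    (h.exists_add_eq_or_eq_three_mul hs ht (mem_of_mem_erase hz)).resolve_right
      (ne_of_mem_erase hz)
  have hcard := card_le_choose_two_of_forall_exists_add hcover
  rw [card_erase_add_one hgX] at hcard
  have := pred_card_le_card_erase (s := D) (a := 3 * s)
  omega

theorem sum_subset_add_card_le (h : SumGraph X D δ ε q) {B : Finset ℕ} (hB : B ⊆ X) :
    ∑ x ∈ B, δ x + #X ≤ ∑ x ∈ X, δ x + #B := by
  have hrest : #(X \ B) ≤ ∑ x ∈ X \ B, δ x := by
    rw [card_eq_sum_ones]
    exact sum_le_sum fun x hx => h.one_le x (sdiff_subset hx)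
  have hcard := card_sdiff_add_card_eq_card hB
  rw [← sum_sdiff hB]
  omega

theorem exists_notMem_weight_le (h : SumGraph X D δ ε q) {b : ℕ} (hb : ∀ x ∈ X, δ x ≤ δ b)
    {B : Finset ℕ} (hB : (#B + 1).choose 2 < #D) : ∃ w ∈ X, w ∉ B ∧ q ≤ δ b + δ w + 1 := by
  have hout : ∃ z ∈ D, ¬ ∃ x ∈ B, ∃ y ∈ B, x + y = z := by
    by_contra! hcon
    exact hB.not_ge (card_le_choose_two_of_forall_exists_add hcon)
  obtain ⟨z, hz, hzB⟩ := hout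
  obtain ⟨x, hx, y, hy, rfl⟩ := h.split z hz
  have hw := h.weight_le hx hy hz
  by_cases hxB : x ∈ B
  · exact ⟨y, hy, fun hyB => hzB ⟨x, hxB, y, hyB, rfl⟩, hw.trans (by gcongr; exact hb x hx)⟩
  · exact ⟨x, hx, hxB, by linarith [hb y hy]⟩

theorem le_two_mul_of_forall_le (h : SumGraph X D δ ε q) {b : ℕ} (hb : ∀ x ∈ X, δ x ≤ δ b)
    (hXD : (X ∩ D).Nonempty) : q ≤ 2 * δ b := by
  obtain ⟨g, hg⟩ := hXD
  obtain ⟨hgX, hgD⟩ := mem_inter.1 hg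
  obtain ⟨s, hs, t, ht, rfl⟩ := h.split g hgD
  linarith [h.weight s hs t ht hgD, h.correction_le_one (s + t), h.one_le _ hgX, hb s hs, hb t ht]

theorem card_le_sum_correction_add_card (h : SumGraph X D δ ε q) {A : Finset ℕ}
    (hA : ∀ x ∈ X, ∀ y ∈ X, q ≤ δ x + δ y → x + y ∈ A) : #D ≤ ∑ z ∈ D, ε z + #A := by
  have hone : #(D \ A) ≤ ∑ z ∈ D, ε z := by
    refine le_trans ?_ (sum_le_sum_of_subset (sdiff_subset (s := D) (t := A)))
    rw [card_eq_sum_ones]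
    refine sum_le_sum fun z hz => ?_
    obtain ⟨hzD, hzA⟩ := mem_sdiff.1 hz
    obtain ⟨x, hx, y, hy, rfl⟩ := h.split z hzD
    by_contra! hε
    exact hzA (hA x hx y hy (by linarith [h.weight x hx y hy hzD]))
  have := le_card_sdiff A D
  omega

theorem mul_card_le_of_card_le (h : SumGraph X D δ ε q) (hXD : (X ∩ D).Nonempty) {e : ℕ}
    (he : 4 ≤ e) (hd : #D ≤ e) : q * #D ≤ e * ∑ x ∈ X, δ x := by
  obtain ⟨b, hbX, hb⟩ := exists_max_image X δ (hXD.mono inter_subset_left)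
  have hq := h.le_two_mul_of_forall_le hb hXD
  rcases le_or_gt #D 2 with hd2 | hd2
  · have hΛ : δ b ≤ ∑ x ∈ X, δ x := single_le_sum (fun _ _ => Nat.zero_le _) hbX
    nlinarith
  · have hn : 3 ≤ #X := by
      by_contra! hn
      have := h.card_le_choose_two_add_one hXD
      have := Nat.choose_le_choose 2 (show #X ≤ 2 by omega)
      norm_num at this
      omega
    obtain ⟨w, hwX, hwb, hw⟩ := h.exists_notMem_weight_le hb (B := {b}) (by simp; omega)
    have hΛ := h.sum_subset_add_card_le (B := {b, w}) (by grind)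
    rw [sum_pair (by grind), card_pair (by grind)] at hΛ
    nlinarith

theorem four_le_card (h : SumGraph X D δ ε q) (hXD : (X ∩ D).Nonempty) (hd : 5 ≤ #D) :
    4 ≤ #X := by
  by_contra! hn
  have := h.card_le_choose_two_add_one hXD
  have := Nat.choose_le_choose 2 (show #X ≤ 3 by omega)
  have : Nat.choose 3 2 = 3 := rfl
  omega

theorem three_mul_le_of_ne (h : SumGraph X D δ ε q) {b u v : ℕ} (hX : 4 ≤ #X) (hb : b ∈ X)
    (hu : u ∈ X.erase b) (hv : v ∈ X.erase b) (huv : u ≠ v) (hqb : q ≤ 2 * δ b)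
    (hquv : q ≤ δ u + δ v + 1) : 3 * q ≤ 2 * ∑ x ∈ X, δ x := by
  have hΛ := h.sum_subset_add_card_le (B := {b, u, v}) (by grind)
  rw [sum_insert (by grind), sum_pair huv] at hΛ
  have := card_le_three (a := b) (b := u) (c := v)
  omega

theorem mul_card_le_of_card_eq_add_one (h : SumGraph X D δ ε q) (hXD : (X ∩ D).Nonempty) {e : ℕ}
    (he : 4 ≤ e) (hp : #(X \ D) + 1 ≤ e) (hd : #D = e + 1) : q * #D ≤ e * ∑ x ∈ X, δ x := by
  obtain ⟨b, hbX, hb⟩ := exists_max_image X δ (hXD.mono inter_subset_left)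
  have hq := h.le_two_mul_of_forall_le hb hXD
  have hX := h.four_le_card hXD (by omega)
  obtain ⟨u, hu, v, hv, huv⟩ := h.exists_weight_le_avoiding hbX (by omega)
  have hcard := h.sum_subset_add_card_le (empty_subset X)
  simp only [sum_empty, card_empty] at hcard
  have hΛ : 3 * q ≤ 2 * ∑ x ∈ X, δ x + 1 := by
    by_cases hne : u = v
    · subst hne
      obtain ⟨w, hwX, hw, hbw⟩ := h.exists_notMem_weight_le hb (B := {b, u}) (by
        rw [card_pair (by grind)]; exact (show Nat.choose 3 2 < #D by norm_num [Nat.choose]; omega))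
      have hΛ := h.sum_subset_add_card_le (B := {b, u, w}) (by grind)
      rw [sum_insert (by grind), sum_pair (by grind)] at hΛ
      have := card_le_three (a := b) (b := u) (c := w)
      omega
    · linarith [h.three_mul_le_of_ne hX hbX hu hv hne hq huv]
  rw [hd]
  rcases le_or_gt q 2 <;> nlinarith

theorem card_le_sum_correction_add_four (h : SumGraph X D δ ε q) {b u v w : ℕ}
    (hb : ∀ x ∈ X, δ x ≤ δ b) (hu : u ∈ X) (hw : w ∈ X) (hvu : δ v ≤ δ u)
    (hbw : δ b + δ w < q) (huv : δ u + δ v < q)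
    (hX : ∀ x ∈ X, x ∉ ({b, u, v, w} : Finset ℕ) → δ x ≤ 1) : #D ≤ ∑ z ∈ D, ε z + 4 := by
  have := h.card_le_sum_correction_add_card (A := {b + b, b + u, b + v, u + u}) ?_
  · exact this.trans (Nat.add_le_add_left card_le_four _)
  intro x hx y hy hxy
  have := h.one_le w hw
  have := h.one_le u hu
  have := hb x hx
  have := hb y hy
  have := hb u hu
  have hx' := hX x hx
  have hy' := hX y hy
  simp only [mem_insert, mem_singleton, not_or] at hx' hy' ⊢
  grind

theorem card_le_sum_correction_add_card_of_le_one (h : SumGraph X D δ ε q) {b : ℕ}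
    (hX : ∀ x ∈ X, x ≠ b → δ x ≤ 1) (hq : 3 ≤ q) : #D ≤ ∑ z ∈ D, ε z + #X := by
  have := h.card_le_sum_correction_add_card (A := X.image (b + ·)) fun x hx y hy hxy => ?_
  · exact this.trans (Nat.add_le_add_left card_image_le _)
  by_cases hxb : x = b
  · exact hxb ▸ mem_image_of_mem _ hy
  by_cases hyb : y = b
  · rw [hyb, add_comm]; exact mem_image_of_mem _ hx
  linarith [hX x hx hxb, hX y hy hyb]

theorem card_le_sum_correction_add_three (h : SumGraph X D δ ε q) {b u : ℕ}
    (hX : ∀ x ∈ X, x ≠ b → x ≠ u → δ x ≤ 1) (hq : 4 ≤ q) (hb : δ b ≤ 2) (hu : δ u ≤ 2) :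
    #D ≤ ∑ z ∈ D, ε z + 3 := by
  have := h.card_le_sum_correction_add_card (A := {b + b, b + u, u + u}) fun x hx y hy hxy => ?_
  · exact this.trans (Nat.add_le_add_left card_le_three _)
  have := hX x hx
  have := hX y hy
  simp only [mem_insert, mem_singleton]
  grind

theorem seven_mul_le_of_eq_insert (h : SumGraph X D δ ε q) {b u v w : ℕ}
    (hX : X = {b, u, v, w}) (hcard : #X = 4) (hd : #D = 7)
    (hb : ∀ x ∈ X, δ x ≤ δ b) (hvu : δ v ≤ δ u) (hqb : q ≤ 2 * δ b)
    (hquv : q ≤ δ u + δ v + 1) (hqbw : q ≤ δ b + δ w + 1) :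
    q * 7 ≤ 4 * ∑ x ∈ X, δ x + ∑ z ∈ D, ε z := by
  have hΛ : ∑ x ∈ X, δ x = δ b + δ u + δ v + δ w := by
    subst hX
    rw [sum_insert, sum_insert, sum_pair] <;> grind [card_le_three]
  have hbu := hb u (by simp [hX])
  have hw1 := h.one_le w (by simp [hX])
  have hu1 := h.one_le u (by simp [hX])
  have hv1 := h.one_le v (by simp [hX])
  by_cases hbig : q ≠ 3 ∧ 2 * q ≤ ∑ x ∈ X, δ x + 1
  · omega
  by_cases hq3 : q = 3
  · by_cases hsix : 6 ≤ ∑ x ∈ X, δ x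
    · omega
    · have := h.card_le_sum_correction_add_card_of_le_one (b := b) (by
        simp only [hX, mem_insert, mem_singleton]
        grind) hq3.ge
      omega
  by_cases hq4 : q = 4
  · have := h.card_le_sum_correction_add_three (b := b) (u := u) (by
      simp only [hX, mem_insert, mem_singleton]
      grind) hq4.ge (by omega) (by omega)
    omega
  · have := h.card_le_sum_correction_add_four hb (u := u) (v := v) (w := w) (by simp [hX])
      (by simp [hX]) hvu (by omega) (by omega) (by simp [hX])
    omega

theorem mul_card_le_of_seven_le (h : SumGraph X D δ ε q) (hXD : (X ∩ D).Nonempty) {b u v : ℕ}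
    (hbX : b ∈ X) (hb : ∀ x ∈ X, δ x ≤ δ b) (hqb : q ≤ 2 * δ b) (hu : u ∈ X.erase b)
    (hv : v ∈ X.erase b) (huv : u ≠ v) (hvu : δ v ≤ δ u) (hquv : q ≤ δ u + δ v + 1) {e : ℕ}
    (he : 4 ≤ e) (hd7 : 7 ≤ #D) (hd : #D ≤ 2 * e) :
    q * #D ≤ e * ∑ x ∈ X, δ x + ∑ z ∈ D, ε z := by
  have hX := h.four_le_card hXD (by omega)
  have hquad : Nat.choose 4 2 = 6 := rfl
  obtain ⟨w, hwX, hw, hqbw⟩ := h.exists_notMem_weight_le hb (B := {b, u, v}) (by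
    have : #{b, u, v} + 1 ≤ 4 := Nat.add_le_add_right card_le_three 1
    have := Nat.choose_le_choose 2 this
    omega)
  have hsub : {b, u, v, w} ⊆ X := by grind
  have hsum : ∑ x ∈ {b, u, v, w}, δ x = δ b + δ u + δ v + δ w := by
    rw [sum_insert, sum_insert, sum_pair] <;> grind
  have hΛ := h.sum_subset_add_card_le hsub
  have hfour : #{b, u, v, w} = 4 := by
    rw [card_insert_of_notMem, card_insert_of_notMem, card_pair] <;> grind
  rw [hsum, hfour] at hΛ
  rcases le_or_gt (2 * q) (∑ x ∈ X, δ x) with hbig | hsmall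
  · calc q * #D ≤ q * (2 * e) := by gcongr
      _ = e * (2 * q) := by ring
      _ ≤ e * ∑ x ∈ X, δ x := by gcongr
      _ ≤ _ := Nat.le_add_right _ _
  rcases hX.eq_or_lt with hX4 | hX5
  · have hd_le := h.card_le_choose_two_add_one hXD
    rw [← hX4, hquad] at hd_le
    have := h.seven_mul_le_of_eq_insert (eq_of_subset_of_card_le hsub (by omega)).symm hX4.symm
      (by omega) hb hvu hqb hquv hqbw
    rw [show #D = 7 by omega]
    nlinarith
  · have hε := h.card_le_sum_correction_add_four hb (mem_of_mem_erase hu) hwX hvu (by omega)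
      (by omega) fun x hx hxB => by
        have := h.sum_subset_add_card_le (insert_subset hx hsub)
        rw [sum_insert hxB, card_insert_of_notMem hxB, hsum, hfour] at this
        omega
    rw [show ∑ x ∈ X, δ x = 2 * q - 1 by omega]
    zify [show 1 ≤ 2 * q by omega] at *
    nlinarith

theorem mul_card_le (h : SumGraph X D δ ε q) {e : ℕ} (he : 4 ≤ e) (hp : #(X \ D) + 1 ≤ e)
    (hd : #D ≤ 2 * e) : q * #D ≤ e * ∑ x ∈ X, δ x + ∑ z ∈ D, ε z := by
  rcases (X ∩ D).eq_empty_or_nonempty with hXD | hXD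
  · have := h.mul_card_le_of_split_sdiff (by
      rw [sdiff_eq_self_of_disjoint (disjoint_iff_inter_eq_empty.2 hXD)]
      exact h.split)
    exact this.trans (by gcongr)
  rcases le_or_gt #D e with hde | hde
  · exact (h.mul_card_le_of_card_le hXD he hde).trans (Nat.le_add_right _ _)
  rcases (show e + 1 ≤ #D from hde).eq_or_lt with hde | hde
  · exact (h.mul_card_le_of_card_eq_add_one hXD he hp hde.symm).trans (Nat.le_add_right _ _)
  obtain ⟨b, hbX, hb⟩ := exists_max_image X δ (hXD.mono inter_subset_left)
  have hqb := h.le_two_mul_of_forall_le hb hXD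
  obtain ⟨u, hu, v, hv, huv, hquv⟩ := h.exists_ne_weight_le_avoiding hbX (by omega)
  have hX := h.four_le_card hXD (by omega)
  rcases le_or_gt #D 6 with hd6 | hd7
  · have := h.three_mul_le_of_ne hX hbX hu hv huv hqb hquv
    obtain rfl : e = 4 := by omega
    rw [show #D = 6 by omega]
    omega
  rcases le_total (δ v) (δ u) with hvu | hvu
  · exact h.mul_card_le_of_seven_le hXD hbX hb hqb hu hv huv hvu hquv he hd7 hd
  · exact h.mul_card_le_of_seven_le hXD hbX hb hqb hv hu huv.symm hvu (by omega) he hd7 hd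

end SumGraph

namespace NumericalSemigroup

variable {T : NumericalSemigroup}

theorem multiplicity_mem (T : NumericalSemigroup) : T.multiplicity ∈ T :=
  T.multiplicity_isLeast.1.1

theorem multiplicity_ne_zero (T : NumericalSemigroup) : T.multiplicity ≠ 0 :=
  T.multiplicity_isLeast.1.2

theorem multiplicity_le {a : ℕ} (ha : a ∈ T) (ha0 : a ≠ 0) : T.multiplicity ≤ a :=
  T.multiplicity_isLeast.2 ⟨ha, ha0⟩

theorem multiplicity_mem_primitives (T : NumericalSemigroup) : T.multiplicity ∈ T.primitives := by
  refine ⟨T.multiplicity_mem, T.multiplicity_ne_zero, fun x hx y _ hx0 hy0 hxy => ?_⟩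
  have := multiplicity_le hx hx0
  omega

theorem mul_mem {a : ℕ} (ha : a ∈ T) (k : ℕ) : k * a ∈ T := by
  simpa using nsmul_mem ha k

theorem exists_add_eq_of_notMem_primitives {a : ℕ} (ha : a ∈ T) (ha0 : a ≠ 0)
    (hP : a ∉ T.primitives) : ∃ x ∈ T, ∃ y ∈ T, x ≠ 0 ∧ y ≠ 0 ∧ x + y = a := by
  contrapose! hP
  exact ⟨ha, ha0, hP⟩

theorem mem_closure_primitives {a : ℕ} (ha : a ∈ T) : a ∈ AddSubmonoid.closure T.primitives := by
  induction a using Nat.strong_induction_on with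
  | _ a ih =>
    by_cases ha0 : a = 0
    · exact ha0 ▸ zero_mem _
    by_cases hP : a ∈ T.primitives
    · exact AddSubmonoid.subset_closure hP
    · obtain ⟨x, hx, y, hy, hx0, hy0, rfl⟩ := exists_add_eq_of_notMem_primitives ha ha0 hP
      exact add_mem (ih x (by omega) hx) (ih y (by omega) hy)

/-- The conductor as a natural number; nothing is lost, since `F ≥ -1`. -/
noncomputable def natConductor (T : NumericalSemigroup) : ℕ :=
  T.conductor.toNat

theorem coe_natConductor (T : NumericalSemigroup) : (T.natConductor : ℤ) = T.conductor := by
  have : -1 ≤ T.frobenius := T.frobenius_isGreatest.2 fun a _ => by omega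
  rw [natConductor, conductor]
  omega

theorem frobenius_eq (T : NumericalSemigroup) : T.frobenius = T.natConductor - 1 := by
  rw [coe_natConductor, conductor, add_sub_cancel_right]

theorem mem_of_natConductor_le {n : ℕ} (hn : T.natConductor ≤ n) : n ∈ T := by
  by_contra h
  have : (n : ℤ) ≤ T.frobenius :=
    T.frobenius_isGreatest.2 fun a ha han => h (Nat.cast_injective han ▸ ha)
  rw [frobenius_eq] at this
  omega

theorem mem_leftPart_iff {a : ℕ} : a ∈ T.leftPart ↔ a ∈ T ∧ a < T.natConductor := by
  refine and_congr_right fun ha => ?_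
  have : (a : ℤ) ≠ T.frobenius := T.frobenius_isGreatest.1 a ha
  rw [frobenius_eq] at this ⊢
  omega

theorem satisfiesWilf_iff :
    T.SatisfiesWilf ↔ T.natConductor ≤ T.embeddingDim * T.leftPart.ncard := by
  rw [SatisfiesWilf, ← coe_natConductor]
  exact_mod_cast Iff.rfl

section PseudoFrobenius

/-- The pseudo-Frobenius numbers of `T`: the gaps that enter `T` when any nonzero element of `T` is
added to them. Their number is the type of `T` (for `T = ℕ` the usual convention also counts `-1`,
which is left out here). -/
def pseudoFrobenius (T : NumericalSemigroup) : Set ℕ :=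
  {f | f ∉ T ∧ ∀ s ∈ T, s ≠ 0 → f + s ∈ T}

theorem pseudoFrobenius_finite (T : NumericalSemigroup) : T.pseudoFrobenius.Finite :=
  T.finite_compl.subset fun _ hf => hf.1

theorem exists_add_mem_pseudoFrobenius {k : ℕ} (hk : k ∉ T) :
    ∃ s ∈ T.leftPart, k + s ∈ T.pseudoFrobenius := by
  have hfin : {s | s ∈ T ∧ k + s ∉ T}.Finite :=
    (Set.finite_lt_nat T.natConductor).subset fun s hs => by
      by_contra h
      exact hs.2 (mem_of_natConductor_le (by simp only [Set.mem_ofPred] at h; omega))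
  obtain ⟨s, ⟨hs, hks⟩, hmax⟩ := Set.exists_max_image _ id hfin ⟨0, zero_mem T, by simpa⟩
  refine ⟨s, mem_leftPart_iff.2 ⟨hs, ?_⟩, hks, fun t ht ht0 => ?_⟩
  · by_contra h
    exact hks (mem_of_natConductor_le (by omega))
  · by_contra h
    have : s + t ≤ s := hmax (s + t) ⟨add_mem hs ht, by rwa [← add_assoc]⟩
    omega

theorem natConductor_le_mul_ncard_leftPart (T : NumericalSemigroup) :
    T.natConductor ≤ (T.pseudoFrobenius.ncard + 1) * T.leftPart.ncard := by
  obtain ⟨L, hL⟩ := T.leftPart_finite.exists_finset_coe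
  obtain ⟨F, hF⟩ := T.pseudoFrobenius_finite.exists_finset_coe
  have hcover : Finset.range T.natConductor ⊆ L ∪ (F ×ˢ L).image fun p => p.1 - p.2 := by
    intro k hk
    rw [Finset.mem_union, ← Finset.mem_coe, hL, mem_leftPart_iff]
    by_cases hkT : k ∈ T
    · exact Or.inl ⟨hkT, Finset.mem_range.1 hk⟩
    · obtain ⟨s, hs, hks⟩ := exists_add_mem_pseudoFrobenius hkT
      rw [← hL, Finset.mem_coe] at hs
      rw [← hF, Finset.mem_coe] at hks
      exact Or.inr (Finset.mem_image.2
        ⟨(k + s, s), Finset.mk_mem_product hks hs, Nat.add_sub_cancel k s⟩)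
  calc T.natConductor = (Finset.range T.natConductor).card := (Finset.card_range _).symm
    _ ≤ (L ∪ (F ×ˢ L).image fun p => p.1 - p.2).card := Finset.card_le_card hcover
    _ ≤ L.card + (F ×ˢ L).card :=
      (Finset.card_union_le _ _).trans (Nat.add_le_add_left Finset.card_image_le _)
    _ = (T.pseudoFrobenius.ncard + 1) * T.leftPart.ncard := by
      rw [← hL, ← hF, Set.ncard_coe_finset, Set.ncard_coe_finset, Finset.card_product]
      ring

end PseudoFrobenius

section ThreeGenerators

variable {m x y f f' i i' j j' : ℕ}

theorem exists_combination (hP : T.primitives = {m, x, y}) {a : ℕ} (ha : a ∈ T) :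
    ∃ k i j : ℕ, a = k * m + i * x + j * y := by
  replace ha := mem_closure_primitives ha
  rw [hP] at ha
  induction ha using AddSubmonoid.closure_induction with
  | mem b hb =>
    rcases hb with rfl | rfl | rfl
    · exact ⟨1, 0, 0, by ring⟩
    · exact ⟨0, 1, 0, by ring⟩
    · exact ⟨0, 0, 1, by ring⟩
  | zero => exact ⟨0, 0, 0, by ring⟩
  | add b c _ _ hb hc =>
    obtain ⟨k, i, j, rfl⟩ := hb
    obtain ⟨k', i', j', rfl⟩ := hc
    exact ⟨k + k', i + i', j + j', by ring⟩

theorem combination_mem (hP : T.primitives = {m, x, y}) (k i j : ℕ) :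
    k * m + i * x + j * y ∈ T := by
  have hsub : ∀ a ∈ ({m, x, y} : Set ℕ), a ∈ T := fun a ha => (hP ▸ ha : a ∈ T.primitives).1
  exact add_mem (add_mem (mul_mem (hsub m (by simp)) k) (mul_mem (hsub x (by simp)) i))
    (mul_mem (hsub y (by simp)) j)

theorem exists_add_eq_of_notMem (hP : T.primitives = {m, x, y}) (hf : f ∉ T) (hfm : f + m ∈ T) :
    ∃ i j : ℕ, f + m = i * x + j * y := by
  obtain ⟨k, i, j, h⟩ := exists_combination hP hfm
  rcases k with _ | k
  · exact ⟨i, j, by omega⟩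
  · refine absurd ?_ hf
    convert combination_mem hP k i j using 1
    linarith

theorem eq_of_mem_pseudoFrobenius_of_le (hP : T.primitives = {m, x, y})
    (hf : f ∈ T.pseudoFrobenius) (hf' : f' ∉ T) (h : f + m = i * x + j * y)
    (h' : f' + m = i' * x + j' * y) (hi : i ≤ i') (hj : j ≤ j') : f = f' := by
  obtain ⟨u, rfl⟩ := Nat.exists_eq_add_of_le hi
  obtain ⟨v, rfl⟩ := Nat.exists_eq_add_of_le hj
  have hadd : f' = f + (0 * m + u * x + v * y) := by linarith
  by_contra hne
  exact hf' (hadd ▸ hf.2 _ (combination_mem hP 0 u v) (by omega))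

theorem exists_add_eq_lt_of_lt (hP : T.primitives = {m, x, y}) (hf : f ∈ T.pseudoFrobenius)
    (hf' : f' ∉ T) (h : f + m = i * x + j * y) (h' : f' + m = i' * x + j' * y) (hi : i < i') :
    ∃ k, ∃ l < j, f + x = k * m + l * y := by
  have hx : x ∈ T.primitives := by simp [hP]
  obtain ⟨k, l, hkl⟩ := exists_add_eq_of_notMem (hP.trans (Set.insert_comm m x {y})) hf.1
    (hf.2 x hx.1 hx.2.1)
  refine ⟨k, l, ?_, hkl⟩
  by_contra! hl
  obtain ⟨u, rfl⟩ := Nat.exists_eq_add_of_lt hi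
  obtain ⟨v, rfl⟩ := Nat.exists_eq_add_of_le hl
  refine hf' ?_
  convert combination_mem hP k u (v + j') using 1
  linarith

theorem not_lt_of_lt_of_mem_pseudoFrobenius (hP : T.primitives = {m, x, y})
    (hf : f ∈ T.pseudoFrobenius) (hf' : f' ∉ T) {f'' i'' j'' : ℕ} (hf'' : f'' ∉ T)
    (h : f + m = i * x + j * y) (hmin : ∀ a b : ℕ, f + m = a * x + b * y → i ≤ a)
    (h' : f' + m = i' * x + j' * y) (h'' : f'' + m = i'' * x + j'' * y) (hi : i < i') :
    ¬ j < j'' := by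
  intro hj
  obtain ⟨k, b, hb, hkb⟩ := exists_add_eq_lt_of_lt hP hf hf' h h' hi
  obtain ⟨l, a, ha, hla⟩ := exists_add_eq_lt_of_lt
    (hP.trans (congrArg (insert m) (Set.pair_comm x y))) hf hf'' (h.trans (add_comm _ _))
    (h''.trans (add_comm _ _)) hj
  -- The relations for `f + x` and `f + y` differ by one that rewrites a part of `f + m`: this gives
  -- either a multiple of `m` in `f + m`, hence `f ∈ T`, or a smaller exponent of `x`.
  have hxy : (a + 1) * x + l * m = (b + 1) * y + k * m := by linarith
  obtain ⟨u, rfl⟩ := Nat.exists_eq_add_of_lt ha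
  obtain ⟨v, rfl⟩ := Nat.exists_eq_add_of_lt hb
  rcases lt_trichotomy k l with hkl | rfl | hkl
  · obtain ⟨w, rfl⟩ := Nat.exists_eq_add_of_lt hkl
    refine hf.1 ?_
    convert combination_mem hP w (a + u + 1 + a + 1) v using 1
    linarith
  · have := hmin u (b + v + 1 + b + 1) (by linarith)
    omega
  · obtain ⟨w, rfl⟩ := Nat.exists_eq_add_of_lt hkl
    refine hf.1 ?_
    convert combination_mem hP w u (b + v + 1 + b + 1) using 1
    linarith

theorem ncard_pseudoFrobenius_le_two (hP : T.primitives = {m, x, y}) :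
    T.pseudoFrobenius.ncard ≤ 2 := by
  classical
  have hm : m ∈ T.primitives := by simp [hP]
  have hrep : ∀ f ∈ T.pseudoFrobenius, ∃ i j, f + m = i * x + j * y ∧
      ∀ a b, f + m = a * x + b * y → i ≤ a := fun f hf => by
    have hex := exists_add_eq_of_notMem hP hf.1 (hf.2 m hm.1 hm.2.1)
    obtain ⟨j, hj⟩ := Nat.find_spec hex
    exact ⟨Nat.find hex, j, hj, fun a b hab => Nat.find_min' hex ⟨b, hab⟩⟩
  choose! α β heq hmin using hrep
  have hanti : ∀ f ∈ T.pseudoFrobenius, ∀ g ∈ T.pseudoFrobenius, α f ≤ α g → f ≠ g →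
      α f < α g ∧ β g < β f := by
    intro f hf g hg hle hne
    have hβ : β g < β f := by
      by_contra! h
      exact hne (eq_of_mem_pseudoFrobenius_of_le hP hf hg.1 (heq f hf) (heq g hg) hle h)
    refine ⟨hle.lt_of_ne fun hα => hne.symm ?_, hβ⟩
    exact eq_of_mem_pseudoFrobenius_of_le hP hg hf.1 (heq g hg) (heq f hf) hα.ge hβ.le
  rcases T.pseudoFrobenius.eq_empty_or_nonempty with hempty | hne
  · simp [hempty]
  obtain ⟨f, hf, hfmin⟩ := Set.exists_min_image _ α T.pseudoFrobenius_finite hne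
  obtain ⟨g, hg, hgmax⟩ := Set.exists_max_image _ α T.pseudoFrobenius_finite hne
  suffices T.pseudoFrobenius ⊆ {f, g} from
    (Set.ncard_le_ncard this).trans (Set.ncard_insert_le f {g} |>.trans (by simp))
  intro h hh
  by_contra hfg
  rw [Set.mem_insert_iff, Set.mem_singleton_iff, not_or] at hfg
  exact not_lt_of_lt_of_mem_pseudoFrobenius hP hh hg.1 hf.1 (heq h hh) (hmin h hh) (heq g hg)
    (heq f hf) (hanti h hh g hg (hgmax h hh) hfg.2).1
    (hanti f hf h hh (hfmin h hh) (Ne.symm hfg.1)).2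

theorem ncard_pseudoFrobenius_le_one (hP : T.primitives = {m, x}) :
    T.pseudoFrobenius.ncard ≤ 1 := by
  have hP : T.primitives = {m, x, x} := by simp [hP]
  have hm : m ∈ T.primitives := by simp [hP]
  have hrep : ∀ f ∈ T.pseudoFrobenius, ∃ i : ℕ, f + m = i * x + 0 * x := fun f hf => by
    obtain ⟨i, j, h⟩ := exists_add_eq_of_notMem hP hf.1 (hf.2 m hm.1 hm.2.1)
    exact ⟨i + j, by linarith⟩
  rw [Set.ncard_le_one T.pseudoFrobenius_finite]
  intro f hf g hg
  obtain ⟨i, hi⟩ := hrep f hf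
  obtain ⟨j, hj⟩ := hrep g hg
  rcases le_total i j with hij | hij
  · exact eq_of_mem_pseudoFrobenius_of_le hP hf hg.1 hi hj hij le_rfl
  · exact (eq_of_mem_pseudoFrobenius_of_le hP hg hf.1 hj hi hij le_rfl).symm

theorem pseudoFrobenius_eq_empty (hP : T.primitives = {m}) : T.pseudoFrobenius = ∅ := by
  have hP : T.primitives = {m, m, m} := by simp [hP]
  have hm : m ∈ T.primitives := by simp [hP]
  refine Set.eq_empty_of_forall_notMem fun f hf => hf.1 ?_
  obtain ⟨i, j, h⟩ := exists_add_eq_of_notMem hP hf.1 (hf.2 m hm.1 hm.2.1)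
  rcases hij : i + j with _ | k
  · have := hm.2.1
    simp_all
  · convert combination_mem hP k 0 0 using 1
    linarith [congrArg (· * m) hij]

theorem ncard_pseudoFrobenius_lt_embeddingDim (he : T.embeddingDim ≤ 3) :
    T.pseudoFrobenius.ncard < T.embeddingDim := by
  have hpos : 0 < T.embeddingDim :=
    (Set.ncard_pos T.primitives_finite).2 ⟨_, T.multiplicity_mem_primitives⟩
  obtain he | he | he : T.embeddingDim = 1 ∨ T.embeddingDim = 2 ∨ T.embeddingDim = 3 := by omega
  · obtain ⟨m, hP⟩ := Set.ncard_eq_one.1 he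
    simp [he, pseudoFrobenius_eq_empty hP]
  · obtain ⟨m, x, -, hP⟩ := Set.ncard_eq_two.1 he
    have := ncard_pseudoFrobenius_le_one hP
    omega
  · obtain ⟨m, x, y, -, -, -, hP⟩ := Set.ncard_eq_three.1 he
    have := ncard_pseudoFrobenius_le_two hP
    omega

theorem satisfiesWilf_of_embeddingDim_le_three (he : T.embeddingDim ≤ 3) : T.SatisfiesWilf :=
  satisfiesWilf_iff.2 (T.natConductor_le_mul_ncard_leftPart.trans
    (Nat.mul_le_mul_right _ (ncard_pseudoFrobenius_lt_embeddingDim he)))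

end ThreeGenerators

open Finset

section Apery

variable {T : NumericalSemigroup} {m x y : ℕ}

open Classical in
/-- The Apéry set of `T` with respect to `m`: the elements `x` of `T` with `x - m ∉ T`, where
`x - m` is an integer. The bound `c + m` only serves to make it a finset. -/
noncomputable def apery (T : NumericalSemigroup) (m : ℕ) : Finset ℕ :=
  {x ∈ range (T.natConductor + m) | x ∈ T ∧ ∀ y ∈ T, y + m ≠ x}

theorem mem_apery : x ∈ T.apery m ↔ x ∈ T ∧ ∀ y ∈ T, y + m ≠ x := by
  classical
  rw [apery, mem_filter, and_iff_right_iff_imp, mem_range]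
  intro hx
  by_contra h
  exact hx.2 (x - m) (mem_of_natConductor_le (by omega)) (by omega)

theorem lt_of_mem_apery (hx : x ∈ T.apery m) : x < T.natConductor + m := by
  classical
  exact mem_range.1 (mem_filter.1 hx).1

theorem mem_of_mem_apery (hx : x ∈ T.apery m) : x ∈ T :=
  (mem_apery.1 hx).1

theorem mem_apery_of_add (hx : x ∈ T) (hy : y ∈ T) (h : x + y ∈ T.apery m) : x ∈ T.apery m :=
  mem_apery.2 ⟨hx, fun w hw hwx =>
    (mem_apery.1 h).2 (w + y) (add_mem hw hy) (by rw [← hwx]; ring)⟩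

theorem zero_mem_apery (hm : m ≠ 0) : 0 ∈ T.apery m :=
  mem_apery.2 ⟨zero_mem T, by omega⟩

theorem exists_apery_add_mul (hm : m ≠ 0) (hx : x ∈ T) : ∃ w ∈ T.apery m, ∃ k, w + k * m = x := by
  induction x using Nat.strong_induction_on with
  | _ x ih =>
    by_cases h : x ∈ T.apery m
    · exact ⟨x, h, 0, by simp⟩
    · simp only [mem_apery, hx, true_and, not_forall, not_not] at h
      obtain ⟨y, hy, rfl⟩ := h
      obtain ⟨w, hw, k, rfl⟩ := ih y (by omega) hy
      exact ⟨w, hw, k + 1, by ring⟩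

theorem eq_of_mem_apery_of_add_mul_eq (hm : m ∈ T) (hx : x ∈ T.apery m) (hy : y ∈ T.apery m)
    {j k : ℕ} (h : x + j * m = y + k * m) : x = y := by
  wlog hjk : j ≤ k generalizing x y j k
  · exact (this hy hx h.symm (le_of_not_ge hjk)).symm
  obtain ⟨l, rfl⟩ := Nat.exists_eq_add_of_le hjk
  rcases l with _ | l
  · exact Nat.add_right_cancel h
  · exact absurd (by linarith) ((mem_apery.1 hx).2 _ (add_mem (mem_of_mem_apery hy) (mul_mem hm l)))

theorem card_apery (hm : m ∈ T) (hm0 : m ≠ 0) : #(T.apery m) = m := by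
  conv_rhs => rw [← card_range m]
  refine card_bij (fun x _ => x % m) (fun x _ => mem_range.2 (Nat.mod_lt _ (by omega))) ?_ ?_
  · intro x hx y hy hxy
    refine eq_of_mem_apery_of_add_mul_eq (j := y / m) (k := x / m) hm hx hy ?_
    linarith [Nat.mod_add_div' x m, Nat.mod_add_div' y m, show x % m = y % m from hxy]
  · intro i hi
    have hle : T.natConductor ≤ i + T.natConductor * m :=
      le_add_left (Nat.le_mul_of_pos_right _ (by omega))
    obtain ⟨w, hw, k, hwk⟩ := exists_apery_add_mul hm0 (mem_of_natConductor_le hle)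
    refine ⟨w, hw, ?_⟩
    rw [← Nat.add_mul_mod_self_right w k m, hwk, Nat.add_mul_mod_self_right,
      Nat.mod_eq_of_lt (mem_range.1 hi)]

/-- The number `δ(x)` of elements `x + j m`, `j ∈ ℕ`, below the conductor. In particular
`T.depth m 0 = ⌈c / m⌉`, the number called `q` in the literature. -/
noncomputable def depth (T : NumericalSemigroup) (m x : ℕ) : ℕ :=
  (T.natConductor + m - 1 - x) / m

theorem lt_depth_iff (hm : m ≠ 0) {j : ℕ} : j < T.depth m x ↔ x + j * m < T.natConductor := by
  rw [depth, ← Nat.succ_le_iff, Nat.le_div_iff_mul_le (Nat.pos_of_ne_zero hm), Nat.succ_mul]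
  omega

theorem natConductor_le_add_depth_mul (hm : m ≠ 0) (x : ℕ) :
    T.natConductor ≤ x + T.depth m x * m :=
  not_lt.1 fun h => lt_irrefl _ ((lt_depth_iff hm).2 h)

theorem add_depth_mul_lt (hx : x < T.natConductor + m) :
    x + T.depth m x * m < T.natConductor + m := by
  rcases Nat.eq_zero_or_pos m with rfl | hm
  · simpa using hx
  rcases h : T.depth m x with _ | k
  · omega
  · have := (lt_depth_iff (T := T) (x := x) hm.ne').1 (by rw [h]; exact Nat.lt_succ_self k)
    linarith

theorem ncard_leftPart_eq_sum_depth (hm : m ∈ T) (hm0 : m ≠ 0) :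
    T.leftPart.ncard = ∑ x ∈ T.apery m, T.depth m x := by
  classical
  have hleft : T.leftPart = ((T.apery m).sigma fun x => range (T.depth m x)).image
      fun p => p.1 + p.2 * m := by
    ext a
    simp only [mem_leftPart_iff, coe_image, coe_sigma, Set.mem_image, Set.mem_sigma_iff, mem_coe,
      mem_range, lt_depth_iff hm0]
    constructor
    · rintro ⟨ha, hac⟩
      obtain ⟨w, hw, k, rfl⟩ := exists_apery_add_mul hm0 ha
      exact ⟨⟨w, k⟩, ⟨hw, hac⟩, rfl⟩
    · rintro ⟨p, ⟨hp, hpc⟩, rfl⟩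
      exact ⟨add_mem (mem_of_mem_apery hp) (mul_mem hm _), hpc⟩
  rw [hleft, Set.ncard_coe_finset, card_image_of_injOn, card_sigma]
  · simp only [card_range]
  · rintro ⟨x, j⟩ hp ⟨y, k⟩ hp' h
    simp only [coe_sigma, Set.mem_sigma_iff, mem_coe] at hp hp' h
    obtain rfl := eq_of_mem_apery_of_add_mul_eq hm hp.1 hp'.1 h
    obtain rfl : j = k := Nat.eq_of_mul_eq_mul_right (Nat.pos_of_ne_zero hm0) (by omega)
    rfl

/-- The nonzero Apéry elements below the conductor. -/
noncomputable def smallApery (T : NumericalSemigroup) (m : ℕ) : Finset ℕ :=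
  {x ∈ T.apery m | x ≠ 0 ∧ x < T.natConductor}

open Classical in
/-- The nonzero Apéry elements that are not primitive. -/
noncomputable def decomposableApery (T : NumericalSemigroup) (m : ℕ) : Finset ℕ :=
  {x ∈ T.apery m | x ≠ 0 ∧ x ∉ T.primitives}

theorem mem_smallApery : x ∈ T.smallApery m ↔ x ∈ T.apery m ∧ x ≠ 0 ∧ x < T.natConductor :=
  mem_filter

theorem mem_decomposableApery :
    x ∈ T.decomposableApery m ↔ x ∈ T.apery m ∧ x ≠ 0 ∧ x ∉ T.primitives := by
  classical
  rw [decomposableApery, mem_filter]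

theorem decomposableApery_subset : T.decomposableApery m ⊆ T.apery m :=
  fun _ hx => (mem_decomposableApery.1 hx).1

theorem ncard_leftPart_eq_depth_zero_add (hm : m ∈ T) (hm0 : m ≠ 0) :
    T.leftPart.ncard = T.depth m 0 + ∑ x ∈ T.smallApery m, T.depth m x := by
  rw [ncard_leftPart_eq_sum_depth hm hm0, ← add_sum_erase _ _ (zero_mem_apery hm0)]
  congr 1
  refine (sum_subset (fun x hx => ?_) fun x hx hxs => ?_).symm
  · have := mem_smallApery.1 hx
    exact mem_erase.2 ⟨this.2.1, this.1⟩
  · rw [mem_erase] at hx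
    have hxc : T.natConductor ≤ x := not_lt.1 fun h => hxs (mem_smallApery.2 ⟨hx.2, hx.1, h⟩)
    exact Nat.eq_zero_of_not_pos fun h => by
      have := (lt_depth_iff hm0).1 h
      omega

open Classical in
theorem card_filter_primitives_add_one (hm : m ∈ T.primitives) :
    #{x ∈ T.apery m | x ∈ T.primitives} + 1 = T.embeddingDim := by
  have hself : m ∉ T.apery m := fun h => (mem_apery.1 h).2 0 (zero_mem T) (zero_add m)
  have hP : T.primitives = ↑(insert m {x ∈ T.apery m | x ∈ T.primitives}) := by
    ext p
    simp only [coe_insert, coe_filter, Set.mem_insert_iff, Set.mem_ofPred]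
    constructor
    · refine fun hp => or_iff_not_imp_left.2 fun hpm => ⟨mem_apery.2 ⟨hp.1, fun y hy h => ?_⟩, hp⟩
      exact hp.2.2 y hy m hm.1 (by rintro rfl; exact hpm (by omega)) hm.2.1 h
    · rintro (rfl | hp)
      exacts [hm, hp.2]
  rw [embeddingDim, hP, Set.ncard_coe_finset, ← hP, card_insert_of_notMem (by simp [hself])]

theorem embeddingDim_add_card_decomposableApery (hm : m ∈ T.primitives) :
    T.embeddingDim + #(T.decomposableApery m) = m := by
  classical
  have hrest : {x ∈ T.apery m | x ∉ T.primitives} = insert 0 (T.decomposableApery m) := by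
    ext x
    rw [mem_filter, mem_insert, mem_decomposableApery]
    by_cases hx : x = 0
    · simp only [hx, zero_mem_apery hm.2.1, true_or, iff_true, true_and]
      exact fun h => h.2.1 rfl
    · simp only [hx, ne_eq, not_false_eq_true, true_and, false_or]
  have hcard := card_filter_add_card_filter_not (s := T.apery m) (· ∈ T.primitives)
  rw [hrest, card_insert_of_notMem (by simp [mem_decomposableApery]), card_apery hm.1 hm.2.1]
    at hcard
  rw [← card_filter_primitives_add_one hm]
  omega

theorem card_smallApery_sdiff_add_one_le (hm : m ∈ T.primitives) :
    #(T.smallApery m \ T.decomposableApery m) + 1 ≤ T.embeddingDim := by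
  classical
  rw [← card_filter_primitives_add_one hm]
  refine Nat.add_le_add_right (card_le_card fun x hx => ?_) 1
  simp only [mem_sdiff, mem_smallApery, mem_decomposableApery, not_and, not_not] at hx
  exact mem_filter.2 ⟨hx.1.1, hx.2 hx.1.1 hx.1.2.1⟩

/-- The correction `ε(z) ∈ {0, 1}` in the near-additivity of `δ`. With `ρ = ⌈c / m⌉ m - c`, it is
`1` exactly when the first number `z + δ(z) m` beyond the conductor in the class of an Apéry element
`z` is among the last `ρ` numbers of the interval `[c, c + m)`. -/
noncomputable def correction (T : NumericalSemigroup) (m z : ℕ) : ℕ :=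
  if T.natConductor + m ≤ z + T.depth m z * m + (T.depth m 0 * m - T.natConductor) then 1 else 0

theorem correction_le_one (T : NumericalSemigroup) (m z : ℕ) : T.correction m z ≤ 1 := by
  rw [correction]
  split_ifs <;> decide

theorem sum_correction_le (hm : m ∈ T) :
    ∑ z ∈ T.apery m, T.correction m z ≤ T.depth m 0 * m - T.natConductor := by
  simp only [correction]
  rw [← card_filter]
  set ρ := T.depth m 0 * m - T.natConductor
  have hIco : #(Ico (T.natConductor + m - ρ) (T.natConductor + m)) ≤ ρ := by
    rw [Nat.card_Ico]
    omega
  refine (card_le_card_of_injOn (fun z => z + T.depth m z * m) (fun z hz => ?_) ?_).trans hIco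
  · simp only [coe_filter, Set.mem_ofPred] at hz
    have := add_depth_mul_lt (lt_of_mem_apery hz.1)
    simp only [coe_Ico, Set.mem_Ico]
    omega
  · intro z hz w hw h
    simp only [coe_filter, Set.mem_ofPred] at hz hw
    exact eq_of_mem_apery_of_add_mul_eq hm hz.1 hw.1 h

theorem depth_zero_add_depth_add_le (hm : m ≠ 0) (h : x + y < T.natConductor + m) :
    T.depth m 0 + T.depth m (x + y) ≤ T.depth m x + T.depth m y + T.correction m (x + y) := by
  have hx := natConductor_le_add_depth_mul (T := T) hm x
  have hy := natConductor_le_add_depth_mul (T := T) hm y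
  have hxy := add_depth_mul_lt h
  have h0 := add_depth_mul_lt (T := T) (x := 0) (m := m) (by omega)
  have h0' := natConductor_le_add_depth_mul (T := T) hm 0
  rw [correction]
  generalize T.depth m x = a at *
  generalize T.depth m y = b at *
  generalize T.depth m (x + y) = k at *
  generalize T.depth m 0 = q at *
  have hle : q + k ≤ a + b + 1 := by
    by_contra! hcon
    have := Nat.mul_le_mul_right m hcon
    linarith
  rcases hle.lt_or_eq with hlt | heq
  · exact le_add_right (by omega)
  · have : q * m + k * m = a * m + b * m + m := by rw [← add_mul, heq]; ring
    rw [if_pos (by omega), heq]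

end Apery

section Wilf

variable {T : NumericalSemigroup}

theorem sumGraph (T : NumericalSemigroup) :
    SumGraph (T.smallApery T.multiplicity) (T.decomposableApery T.multiplicity)
      (T.depth T.multiplicity) (T.correction T.multiplicity) (T.depth T.multiplicity 0) where
  pos x hx := Nat.pos_of_ne_zero (mem_smallApery.1 hx).2.1
  split z hz := by
    obtain ⟨hz, hz0, hzP⟩ := mem_decomposableApery.1 hz
    obtain ⟨a, ha, b, hb, ha0, hb0, rfl⟩ :=
      exists_add_eq_of_notMem_primitives (mem_of_mem_apery hz) hz0 hzP
    have := lt_of_mem_apery hz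
    have := multiplicity_le ha ha0
    have := multiplicity_le hb hb0
    exact ⟨a, mem_smallApery.2 ⟨mem_apery_of_add ha hb hz, ha0, by omega⟩,
      b, mem_smallApery.2 ⟨mem_apery_of_add hb ha (add_comm a b ▸ hz), hb0, by omega⟩, rfl⟩
  closed x hx y hy w hw hxyw := by
    obtain ⟨hx, hx0, -⟩ := mem_smallApery.1 hx
    obtain ⟨hw, hw0, -⟩ := mem_smallApery.1 hw
    have hy := mem_of_mem_apery (mem_smallApery.1 hy).1
    have hxyw := (mem_decomposableApery.1 hxyw).1
    have := lt_of_mem_apery hxyw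
    have := multiplicity_le (mem_of_mem_apery hw) hw0
    exact mem_smallApery.2 ⟨mem_apery_of_add (add_mem (mem_of_mem_apery hx) hy)
      (mem_of_mem_apery hw) hxyw, by omega, by omega⟩
  weight x _ y _ hxy := depth_zero_add_depth_add_le T.multiplicity_ne_zero
    (lt_of_mem_apery (mem_decomposableApery.1 hxy).1)
  one_le x hx := (lt_depth_iff T.multiplicity_ne_zero).2 (by simpa using (mem_smallApery.1 hx).2.2)
  correction_le_one := T.correction_le_one _

theorem satisfiesWilf_of_depth_mul_card_le {m : ℕ} (hm : m ∈ T.primitives)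
    (h : T.depth m 0 * #(T.decomposableApery m) ≤
      T.embeddingDim * ∑ x ∈ T.smallApery m, T.depth m x + (T.depth m 0 * m - T.natConductor)) :
    T.SatisfiesWilf := by
  have hqm : T.depth m 0 * m =
      T.embeddingDim * T.depth m 0 + T.depth m 0 * #(T.decomposableApery m) := by
    rw [mul_comm T.embeddingDim, ← mul_add, embeddingDim_add_card_decomposableApery hm]
  have hc := natConductor_le_add_depth_mul (T := T) hm.2.1 0
  rw [satisfiesWilf_iff, ncard_leftPart_eq_depth_zero_add hm.1 hm.2.1, mul_add]
  omega

theorem satisfiesWilf_of_multiplicity_le_three_mul_embeddingDim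
    (h : T.multiplicity ≤ 3 * T.embeddingDim) : T.SatisfiesWilf := by
  rcases le_or_gt T.embeddingDim 3 with he | he
  · exact satisfiesWilf_of_embeddingDim_le_three he
  have hmP := T.multiplicity_mem_primitives
  have hm := embeddingDim_add_card_decomposableApery hmP
  refine satisfiesWilf_of_depth_mul_card_le hmP ((T.sumGraph.mul_card_le he
    (card_smallApery_sdiff_add_one_le hmP) (by omega)).trans (Nat.add_le_add_left ?_ _))
  exact (sum_le_sum_of_subset decomposableApery_subset).trans (sum_correction_le T.multiplicity_mem)

end Wilf

section Descendants

variable {S T A B : NumericalSemigroup}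

theorem multiplicity_mem_leftPart {a : ℕ} (ha : a ∈ S.leftPart) (ha0 : a ≠ 0) :
    S.multiplicity ∈ S.leftPart := by
  rw [mem_leftPart_iff] at ha ⊢
  exact ⟨S.multiplicity_mem, (multiplicity_le ha.1 ha0).trans_lt ha.2⟩

theorem IsChild.primitives_inter_leftPart_subset (h : B.IsChild A) :
    A.primitives ∩ A.leftPart ⊆ B.primitives ∩ B.leftPart := by
  obtain ⟨a, ⟨-, -, haF⟩, hBA⟩ := h
  have hmem : ∀ x, x ∈ B ↔ x ∈ A ∧ x ≠ a := fun x => by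
    rw [← SetLike.mem_coe, hBA, Set.mem_sdiff, Set.mem_singleton_iff, SetLike.mem_coe]
  have haB : (a : ℤ) ≤ B.frobenius := B.frobenius_isGreatest.2 fun b hb hba =>
    ((hmem b).1 hb).2 (Nat.cast_injective hba)
  rintro p ⟨⟨hpA, hp0, hp⟩, -, hpF⟩
  have hpB : p ∈ B := (hmem p).2 ⟨hpA, by omega⟩
  exact ⟨⟨hpB, hp0, fun x hx y hy => hp x ((hmem x).1 hx).1 y ((hmem y).1 hy).1⟩, hpB, by omega⟩

theorem IsDescendant.primitives_inter_leftPart_subset (h : T.IsDescendant S) :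
    S.primitives ∩ S.leftPart ⊆ T.primitives ∩ T.leftPart := by
  induction h with
  | refl => exact subset_rfl
  | tail _ hchild ih => exact ih.trans hchild.primitives_inter_leftPart_subset

theorem IsDescendant.numLeftPrimitives_le_embeddingDim (h : T.IsDescendant S) :
    S.numLeftPrimitives ≤ T.embeddingDim :=
  Set.ncard_le_ncard (h.primitives_inter_leftPart_subset.trans Set.inter_subset_left)
    T.primitives_finite

theorem IsDescendant.multiplicity_le (h : T.IsDescendant S) (hS : S.numLeftPrimitives ≠ 0) :
    T.multiplicity ≤ S.multiplicity := by
  obtain ⟨p, hp, hpL⟩ := Set.nonempty_of_ncard_ne_zero hS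
  have hm := h.primitives_inter_leftPart_subset
    ⟨S.multiplicity_mem_primitives, multiplicity_mem_leftPart hpL hp.2.1⟩
  exact NumericalSemigroup.multiplicity_le hm.1.1 S.multiplicity_ne_zero

end Descendants

end NumericalSemigroup

theorem mainTheorem4 (S : NumericalSemigroup)
    (hS : S ≠ NumericalSemigroup.ordinary S.multiplicity)
    (hel : (S.multiplicity : ℚ) / 3 ≤ (S.numLeftPrimitives : ℚ))
    (T : NumericalSemigroup) (hT : T.IsDescendant S) :
    T.SatisfiesWilf := by
  have hm : S.multiplicity ≤ 3 * S.numLeftPrimitives := by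
    rw [div_le_iff₀' (by norm_num)] at hel
    exact_mod_cast hel
  have hne : S.numLeftPrimitives ≠ 0 := by
    have := S.multiplicity_ne_zero
    omega
  refine NumericalSemigroup.satisfiesWilf_of_multiplicity_le_three_mul_embeddingDim ?_
  calc T.multiplicity ≤ S.multiplicity := hT.multiplicity_le hne
    _ ≤ 3 * S.numLeftPrimitives := hm
    _ ≤ 3 * T.embeddingDim := Nat.mul_le_mul_left 3 hT.numLeftPrimitives_le_embeddingDim
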